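/- All graphs are finite and simple. For a graph $G$ on $n$ vertices let $m_k(G)$ be the number of sets of $k$ pairwise vertex-disjoint edges of $G$, let $m(G,x)=\sum_{0\le k\le n/2}(-1)^k m_k(G)\,x^{n-2k}$ be its matching polynomial, and let $t(G)$ be the largest real root of $m(G,x)$. For graphs $G_1,G_2$ write $G_1\succ G_2$ if $m(G_2,x)>m(G_1,x)$ for all real $x\ge t(G_1)$. For distinct vertices $u,v$ of $G$, the Kelmans transformation $KT(G,u,v)$ is the graph obtained from $G$ by deleting the edge $vw$ and adding the edge $uw$ for every neighbour $w$ of $v$ in $G$ such that $w\ne u$ and $w$ is not adjacent to $u$ in $G$. Theorem. Let $G$ be a connected graph, and let $G'$ be obtained from $G$ by a finite sequence of Kelmans transformations, with $G'$ not isomorphic to $G$. Then the largest real roots $t(G)$ and $t(G')$ exist, and $G'\succ G$, i.e. $m(G,x)>m(G',x)$ for all real $x\ge t(G')$. In particular $t(G')>t(G)$. -/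

import Mathlib

open Polynomial

namespace SimpleGraph

/-- The matchings of `G` with exactly `k` edges: sets of `k` edges of `G`, no two of which share a
vertex. -/
noncomputable def kMatchings {V : Type*} [Fintype V] (G : SimpleGraph V) (k : ℕ) :
    Finset (Finset (Sym2 V)) :=
  open Classical in
  Finset.univ.filter fun M : Finset (Sym2 V) =>
    (∀ e ∈ M, e ∈ G.edgeSet) ∧ M.card = k ∧
      ∀ e ∈ M, ∀ f ∈ M, e ≠ f → ∀ v : V, v ∈ e → v ∉ f

/-- The matching polynomial `∑ₖ (-1)ᵏ mₖ(G) xⁿ⁻²ᵏ`, where `n` is the number of vertices and `mₖ(G)`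
is the number of matchings with `k` edges. As `mₖ(G) = 0` for `2k > n`, the sum runs over
`k ≤ n / 2` (so the natural subtraction in the exponent is never truncated). -/
noncomputable def matchingPolynomial {V : Type*} [Fintype V] (G : SimpleGraph V) : ℝ[X] :=
  ∑ k ∈ Finset.range (Fintype.card V / 2 + 1),
    C ((-1 : ℝ) ^ k * ((G.kMatchings k).card : ℝ)) * X ^ (Fintype.card V - 2 * k)

/-- The set of (real) roots of the matching polynomial. -/
def matchingRoots {V : Type*} [Fintype V] (G : SimpleGraph V) : Set ℝ :=
  {x : ℝ | G.matchingPolynomial.eval x = 0}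

/-- The maximum matching root `t(G)`. The set of roots is finite, so this supremum is a maximum
as soon as there is a root. -/
noncomputable def maxMatchingRoot {V : Type*} [Fintype V] (G : SimpleGraph V) : ℝ :=
  sSup G.matchingRoots

/-- `G₁ ≻ G₂`: for all `x ≥ t(G₁)` we have `m(G₂, x) > m(G₁, x)`. -/
def MatchingSucc {V W : Type*} [Fintype V] [Fintype W]
    (G₁ : SimpleGraph V) (G₂ : SimpleGraph W) : Prop :=
  ∀ x : ℝ, G₁.maxMatchingRoot ≤ x →
    G₁.matchingPolynomial.eval x < G₂.matchingPolynomial.eval x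

/-- The vertices moved by the Kelmans transformation: the neighbours `w` of `v` with `w ≠ u` and
`w` not adjacent to `u`. -/
def kelmansMoved {V : Type*} (G : SimpleGraph V) (u v : V) : Set V :=
  {w : V | G.Adj v w ∧ w ≠ u ∧ ¬ G.Adj u w}

/-- The Kelmans transformation with beneficiary `u` and co-beneficiary `v`: for every moved vertex
`w`, the edge `vw` is deleted and the edge `uw` is added. -/
def kelmans {V : Type*} (G : SimpleGraph V) (u v : V) : SimpleGraph V :=
  fromEdgeSet
    ((G.edgeSet \ {e | ∃ w ∈ G.kelmansMoved u v, e = s(v, w)}) ∪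
      {e | ∃ w ∈ G.kelmansMoved u v, e = s(u, w)})

/-- `H` arises from `G` by one Kelmans transformation between two distinct vertices. -/
def KelmansStep {V : Type*} (G H : SimpleGraph V) : Prop :=
  ∃ u v : V, u ≠ v ∧ H = G.kelmans u v

end SimpleGraph

/-! Write m(S, x) for the matching polynomial of the subgraph induced by a vertex set S. Expanding
at u and v shows that one Kelmans transformation lowers m(G, x) by exactly the sum of m(V \ {u, v,
a, b}, x) over a in N(u) \ N(v) and b in N(v) \ N(u), with a ≠ v and b ≠ u
(`matchingEval_sub_kelmans`). The sets in this sum avoid u and v, so they induce the same graph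
before and after the transformation.

To the right of the largest root, induced subgraphs have nonnegative value
(`matchingEval_pos_of_subset`). The value is strictly positive at the root too if the set misses a
non-isolated vertex and all edges lie in one component (`EdgesConnected.matchingEval_pos`). Hence a
step with a nonempty sum is strict. If the sum is empty, one neighbourhood contains the other and
the step yields an isomorphic graph.

A step can isolate v and destroy connectedness, so the property carried along the sequence is
`EdgesConnected`. -/

namespace SimpleGraph

section Classical

open scoped Classical

variable {V : Type*} [Fintype V]

/-! ### Matchings of induced subgraphs and the vertex recursion -/

/-- The matchings of `G` all of whose edges have both ends in `S`. -/
noncomputable def matchingsWithin (G : SimpleGraph V) (S : Finset V) :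
    Finset (Finset (Sym2 V)) :=
  Finset.univ.filter fun M : Finset (Sym2 V) =>
    (∀ e ∈ M, e ∈ G.edgeSet ∧ ∀ v ∈ e, v ∈ S) ∧
      ∀ e ∈ M, ∀ f ∈ M, e ≠ f → ∀ v : V, v ∈ e → v ∉ f

theorem mem_matchingsWithin {G : SimpleGraph V} {S : Finset V} {M : Finset (Sym2 V)} :
    M ∈ G.matchingsWithin S ↔ (∀ e ∈ M, e ∈ G.edgeSet ∧ ∀ v ∈ e, v ∈ S) ∧
      ∀ e ∈ M, ∀ f ∈ M, e ≠ f → ∀ v : V, v ∈ e → v ∉ f := by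
  simp [matchingsWithin]

/-- The value at `x` of the matching polynomial of the subgraph of `G` induced by `S`. -/
noncomputable def matchingEval (G : SimpleGraph V) (S : Finset V) (x : ℝ) : ℝ :=
  ∑ M ∈ G.matchingsWithin S, (-1) ^ M.card * x ^ (S.card - 2 * M.card)

/-- Disjoint edges occupy two vertices of S each. This bound keeps the truncated exponents in
`matchingEval` exact. -/
theorem two_mul_card_le_of_mem_matchingsWithin {G : SimpleGraph V} {S : Finset V}
    {M : Finset (Sym2 V)} (hM : M ∈ G.matchingsWithin S) : 2 * M.card ≤ S.card := by
  rw [mem_matchingsWithin] at hM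
  have hcard : (M.biUnion Sym2.toFinset).card = ∑ e ∈ M, e.toFinset.card := by
    apply Finset.card_biUnion
    intro e he f hf hef
    rw [Function.onFun, Finset.disjoint_left]
    intro v hv
    rw [Sym2.mem_toFinset] at hv ⊢
    exact hM.2 e he f hf hef v hv
  have h2 : ∑ e ∈ M, e.toFinset.card = ∑ e ∈ M, 2 :=
    Finset.sum_congr rfl fun e he =>
      Sym2.card_toFinset_of_not_isDiag e (G.not_isDiag_of_mem_edgeSet (hM.1 e he).1)
  have hsub : M.biUnion Sym2.toFinset ⊆ S := by
    intro v hv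
    obtain ⟨e, he, hve⟩ := Finset.mem_biUnion.1 hv
    exact (hM.1 e he).2 v (Sym2.mem_toFinset.1 hve)
  have := Finset.card_le_card hsub
  rw [hcard, h2, Finset.sum_const, smul_eq_mul] at this
  omega

theorem eval_matchingPolynomial (G : SimpleGraph V) (x : ℝ) :
    G.matchingPolynomial.eval x = G.matchingEval Finset.univ x := by
  have hmaps : ∀ M ∈ G.matchingsWithin Finset.univ,
      M.card ∈ Finset.range (Fintype.card V / 2 + 1) := by
    intro M hM
    have := two_mul_card_le_of_mem_matchingsWithin hM
    rw [Finset.card_univ] at this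
    rw [Finset.mem_range]
    omega
  rw [matchingEval, ← Finset.sum_fiberwise_of_maps_to hmaps, matchingPolynomial,
    Polynomial.eval_finsetSum]
  refine Finset.sum_congr rfl fun k _ => ?_
  have hk : (G.matchingsWithin Finset.univ).filter (fun M => M.card = k) = G.kMatchings k := by
    ext M
    simp only [Finset.mem_filter, mem_matchingsWithin, kMatchings, Finset.mem_univ, true_and,
      implies_true, and_true]
    tauto
  rw [hk, Finset.sum_congr rfl (g := fun _ => (-1 : ℝ) ^ k * x ^ (Fintype.card V - 2 * k))]
  · simp only [Polynomial.eval_mul, Polynomial.eval_C, Polynomial.eval_pow, Polynomial.eval_X,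
      Finset.sum_const, nsmul_eq_mul]
    ring
  · intro M hM
    rw [← hk, Finset.mem_filter] at hM
    rw [hM.2, Finset.card_univ]

theorem matchingEval_congr {G H : SimpleGraph V} {S : Finset V}
    (h : ∀ a ∈ S, ∀ b ∈ S, (G.Adj a b ↔ H.Adj a b)) (x : ℝ) :
    G.matchingEval S x = H.matchingEval S x := by
  have : G.matchingsWithin S = H.matchingsWithin S := by
    ext M
    rw [mem_matchingsWithin, mem_matchingsWithin]
    refine and_congr_left fun _ => forall₂_congr fun e _ => and_congr_left fun he => ?_
    induction e with | _ a b =>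
    exact h a (he a (Sym2.mem_mk_left a b)) b (he b (Sym2.mem_mk_right a b))
  rw [matchingEval, matchingEval, this]

theorem matchingEval_empty (G : SimpleGraph V) (x : ℝ) : G.matchingEval ∅ x = 1 := by
  have : G.matchingsWithin ∅ = {∅} := by
    ext M
    rw [mem_matchingsWithin, Finset.mem_singleton]
    constructor
    · rintro ⟨h, -⟩
      rw [Finset.eq_empty_iff_forall_notMem]
      intro e he
      have := (h e he).2
      induction e with | _ a b =>
      exact absurd (this a (Sym2.mem_mk_left a b)) (Finset.notMem_empty a)
    · rintro rfl
      simp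
  simp [matchingEval, this]

/-- A matching either misses v or contains exactly one edge vw, and then the rest avoids both v and
w. -/
theorem matchingsWithin_insert (G : SimpleGraph V) {S : Finset V} {v : V} (hv : v ∉ S) :
    G.matchingsWithin (insert v S) = G.matchingsWithin S ∪
      (S.filter (G.Adj v)).biUnion
        fun w => (G.matchingsWithin (S.erase w)).image (insert s(v, w)) := by
  ext M
  simp only [Finset.mem_union, Finset.mem_biUnion, Finset.mem_filter, Finset.mem_image]
  constructor
  · intro hM
    have hM' := mem_matchingsWithin.1 hM
    by_cases hcov : ∃ e ∈ M, v ∈ e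
    · right
      obtain ⟨e, he, hve⟩ := hcov
      obtain ⟨w, rfl⟩ := hve
      have hadj : G.Adj v w := (hM'.1 _ he).1
      have hwS : w ∈ S := by
        have := (hM'.1 _ he).2 w (Sym2.mem_mk_right v w)
        exact (Finset.mem_insert.1 this).resolve_left hadj.ne'
      refine ⟨w, ⟨hwS, hadj⟩, M.erase s(v, w), ?_, Finset.insert_erase he⟩
      rw [mem_matchingsWithin]
      refine ⟨fun f hf => ?_, fun f hf g hg => hM'.2 f (Finset.mem_of_mem_erase hf) g
        (Finset.mem_of_mem_erase hg)⟩
      obtain ⟨hne, hfM⟩ := Finset.mem_erase.1 hf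
      refine ⟨(hM'.1 f hfM).1, fun z hz => ?_⟩
      have hz' := hM'.2 f hfM _ he hne z hz
      rw [Sym2.mem_iff, not_or] at hz'
      exact Finset.mem_erase.2
        ⟨hz'.2, (Finset.mem_insert.1 ((hM'.1 f hfM).2 z hz)).resolve_left hz'.1⟩
    · left
      push Not at hcov
      rw [mem_matchingsWithin]
      refine ⟨fun e he => ⟨(hM'.1 e he).1, fun z hz => ?_⟩, hM'.2⟩
      refine (Finset.mem_insert.1 ((hM'.1 e he).2 z hz)).resolve_left ?_
      rintro rfl
      exact hcov e he hz
  · rintro (hM | ⟨w, ⟨hwS, hadj⟩, N, hN, rfl⟩)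
    · rw [mem_matchingsWithin] at hM ⊢
      exact ⟨fun e he => ⟨(hM.1 e he).1,
        fun z hz => Finset.mem_insert_of_mem ((hM.1 e he).2 z hz)⟩, hM.2⟩
    · rw [mem_matchingsWithin] at hN ⊢
      have key : ∀ f ∈ N, ∀ z ∈ f, z ∉ s(v, w) := by
        intro f hf z hz hz'
        have := Finset.mem_erase.1 ((hN.1 f hf).2 z hz)
        rcases Sym2.mem_iff.1 hz' with rfl | rfl
        · exact hv this.2
        · exact this.1 rfl
      refine ⟨fun e he => ?_, fun e he f hf hef z hze hzf => ?_⟩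
      · rcases Finset.mem_insert.1 he with rfl | he
        · refine ⟨hadj, fun z hz => ?_⟩
          rcases Sym2.mem_iff.1 hz with rfl | rfl
          · exact Finset.mem_insert_self _ _
          · exact Finset.mem_insert_of_mem hwS
        · exact ⟨(hN.1 e he).1, fun z hz =>
            Finset.mem_insert_of_mem (Finset.mem_of_mem_erase ((hN.1 e he).2 z hz))⟩
      · rcases Finset.mem_insert.1 he with rfl | he <;>
          rcases Finset.mem_insert.1 hf with rfl | hf
        · exact hef rfl
        · exact key f hf z hzf hze
        · exact key e he z hze hzf
        · exact hN.2 e he f hf hef z hze hzf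

theorem matchingEval_insert (G : SimpleGraph V) {S : Finset V} {v : V} (hv : v ∉ S) (x : ℝ) :
    G.matchingEval (insert v S) x = x * G.matchingEval S x -
      ∑ w ∈ S, (if G.Adj v w then 1 else 0) * G.matchingEval (S.erase w) x := by
  have hnot : ∀ {T : Finset V} {M : Finset (Sym2 V)}, v ∉ T → M ∈ G.matchingsWithin T →
      ∀ w, s(v, w) ∉ M := fun hT hM w hmem =>
    hT (((mem_matchingsWithin.1 hM).1 _ hmem).2 v (Sym2.mem_mk_left v w))
  have hverase : ∀ w, v ∉ S.erase w := fun w h => hv (Finset.mem_of_mem_erase h)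
  have hdisj : Disjoint (G.matchingsWithin S) ((S.filter (G.Adj v)).biUnion
      fun w => (G.matchingsWithin (S.erase w)).image (insert s(v, w))) := by
    rw [Finset.disjoint_left]
    intro M hM hM'
    simp only [Finset.mem_biUnion, Finset.mem_image] at hM'
    obtain ⟨w, -, N, -, rfl⟩ := hM'
    exact hnot hv hM w (Finset.mem_insert_self _ _)
  have hpair : ((S.filter (G.Adj v) : Finset V) : Set V).PairwiseDisjoint
      fun w => (G.matchingsWithin (S.erase w)).image (insert s(v, w)) := by
    intro a _ b _ hab
    rw [Function.onFun, Finset.disjoint_left]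
    intro M hM hM'
    obtain ⟨N, hN, rfl⟩ := Finset.mem_image.1 hM
    obtain ⟨N', hN', h⟩ := Finset.mem_image.1 hM'
    have hmem : s(v, a) ∈ insert s(v, b) N' := h ▸ Finset.mem_insert_self _ _
    rcases Finset.mem_insert.1 hmem with h' | h'
    · exact hab (Sym2.congr_right.1 h')
    · exact hnot (hverase b) hN' a h'
  rw [matchingEval, matchingsWithin_insert G hv, Finset.sum_union hdisj,
    Finset.sum_biUnion hpair, Finset.card_insert_of_notMem hv, sub_eq_add_neg]
  congr 1
  · rw [matchingEval, Finset.mul_sum]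
    refine Finset.sum_congr rfl fun M hM => ?_
    have := two_mul_card_le_of_mem_matchingsWithin hM
    rw [show S.card + 1 - 2 * M.card = S.card - 2 * M.card + 1 by omega]
    ring
  · rw [← Finset.sum_neg_distrib, Finset.sum_filter]
    refine Finset.sum_congr rfl fun w hw => ?_
    split_ifs with hadj
    · rw [Finset.sum_image, matchingEval, one_mul, ← Finset.sum_neg_distrib]
      · refine Finset.sum_congr rfl fun M hM => ?_
        rw [Finset.card_insert_of_notMem (hnot (hverase w) hM w), Finset.card_erase_of_mem hw,
          show S.card + 1 - 2 * (M.card + 1) = S.card - 1 - 2 * M.card by omega]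
        ring
      · intro M hM N hN h
        rw [← Finset.erase_insert (hnot (hverase w) hM w),
          ← Finset.erase_insert (hnot (hverase w) hN w)]
        exact congrArg (fun T => Finset.erase T s(v, w)) h
    · simp

theorem matchingEval_singleton (G : SimpleGraph V) (v : V) (x : ℝ) :
    G.matchingEval {v} x = x := by
  have := G.matchingEval_insert (Finset.notMem_empty v) x
  simpa [matchingEval_empty] using this

/-! ### Largest roots of induced subgraphs -/

theorem continuous_matchingEval (G : SimpleGraph V) (S : Finset V) :
    Continuous (G.matchingEval S) := by
  unfold matchingEval
  fun_prop

/-- Positivity and monotonicity support each other in the induction: the recursion at w subtracts at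
most |V| terms, each at most m(S \ w), from x · m(S \ w), so at least m(S \ w) is left. This bounds
all roots. -/
theorem matchingEval_pos_of_card_lt (G : SimpleGraph V) {x : ℝ}
    (hx : (Fintype.card V : ℝ) + 1 ≤ x) (S : Finset V) :
    0 < G.matchingEval S x ∧
      ∀ w ∈ S, G.matchingEval (S.erase w) x ≤ G.matchingEval S x := by
  induction S using Finset.strongInduction with | _ S ih =>
  have hle : ∀ w ∈ S, G.matchingEval (S.erase w) x ≤ G.matchingEval S x := by
    intro w hw
    obtain ⟨hpos, hmono⟩ := ih _ (Finset.erase_ssubset hw)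
    have hrec := G.matchingEval_insert (Finset.notMem_erase w S) x
    rw [Finset.insert_erase hw] at hrec
    have hsum : ∑ z ∈ S.erase w, (if G.Adj w z then (1 : ℝ) else 0) *
        G.matchingEval ((S.erase w).erase z) x ≤
        ∑ _z ∈ S.erase w, G.matchingEval (S.erase w) x := by
      refine Finset.sum_le_sum fun z hz => ?_
      split_ifs
      · rw [one_mul]
        exact hmono z hz
      · rw [zero_mul]
        exact hpos.le
    rw [Finset.sum_const, nsmul_eq_mul] at hsum
    have hcard : (((S.erase w).card : ℕ) : ℝ) ≤ Fintype.card V := by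
      exact_mod_cast Finset.card_le_univ _
    nlinarith
  refine ⟨?_, hle⟩
  rcases S.eq_empty_or_nonempty with rfl | ⟨w, hw⟩
  · simp [matchingEval_empty]
  · exact (ih _ (Finset.erase_ssubset hw)).1.trans_le (hle w hw)

theorem exists_greatest_matchingEval_root (G : SimpleGraph V) (S : Finset V) {y : ℝ}
    (hy : G.matchingEval S y ≤ 0) :
    ∃ t, y ≤ t ∧ G.matchingEval S t = 0 ∧ ∀ z, t < z → 0 < G.matchingEval S z := by
  have hcont := G.continuous_matchingEval S
  have hbdd : BddAbove {z | G.matchingEval S z ≤ 0} := by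
    refine ⟨(Fintype.card V : ℝ) + 1, fun z hz => ?_⟩
    by_contra! hlt
    exact absurd (G.matchingEval_pos_of_card_lt hlt.le S).1 (not_lt.2 hz)
  have hclosed : IsClosed {z | G.matchingEval S z ≤ 0} := isClosed_le hcont continuous_const
  have hmem := hclosed.csSup_mem ⟨y, hy⟩ hbdd
  set t := sSup {z | G.matchingEval S z ≤ 0} with ht
  have hpos : ∀ z, t < z → 0 < G.matchingEval S z := by
    intro z hz
    by_contra! hle
    exact absurd (le_csSup hbdd hle) (not_le.2 hz)
  refine ⟨t, le_csSup hbdd hy, le_antisymm hmem ?_, hpos⟩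
  refine ge_of_tendsto (hcont.continuousWithinAt (s := Set.Ioi t)) ?_
  filter_upwards [self_mem_nhdsWithin] with z hz using (hpos z hz).le

/-- A weak form of interlacing. At the greatest root t of m(S \ v), the recursion leaves minus a sum
of values that are nonnegative by induction, so m(S, t) ≤ 0 and t cannot exceed x. -/
theorem matchingEval_pos_of_subset (G : SimpleGraph V) (S : Finset V) :
    ∀ {x : ℝ}, (∀ y, x < y → 0 < G.matchingEval S y) →
      ∀ T ⊆ S, ∀ y, x < y → 0 < G.matchingEval T y := by
  induction S using Finset.strongInduction with | _ S ih =>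
  intro x hS
  have herase : ∀ v ∈ S, ∀ y, x < y → 0 < G.matchingEval (S.erase v) y := by
    intro v hv y hxy
    by_contra! hle
    obtain ⟨t, hyt, ht, hpos⟩ := G.exists_greatest_matchingEval_root _ hle
    have hsub := ih _ (Finset.erase_ssubset hv) hpos
    have hrec := G.matchingEval_insert (Finset.notMem_erase v S) t
    rw [Finset.insert_erase hv, ht, mul_zero, zero_sub] at hrec
    have hsum : 0 ≤ ∑ z ∈ S.erase v, (if G.Adj v z then (1 : ℝ) else 0) *
        G.matchingEval ((S.erase v).erase z) t := by
      refine Finset.sum_nonneg fun z _ => mul_nonneg (by split_ifs <;> norm_num) ?_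
      refine ge_of_tendsto ((G.continuous_matchingEval _).continuousWithinAt
        (s := Set.Ioi t)) ?_
      filter_upwards [self_mem_nhdsWithin] with y hy
      exact (hsub _ (Finset.erase_subset _ _) y hy).le
    have := hS t (hxy.trans_le hyt)
    linarith
  intro T hT
  rcases hT.eq_or_ssubset with rfl | hlt
  · exact hS
  · obtain ⟨v, hvS, hvT⟩ := Finset.exists_of_ssubset hlt
    exact ih _ (Finset.erase_ssubset hvS) (herase v hvS) T (Finset.subset_erase.2 ⟨hT, hvT⟩)

theorem isGreatest_maxMatchingRoot [Nonempty V] (G : SimpleGraph V) :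
    IsGreatest G.matchingRoots G.maxMatchingRoot ∧
      ∀ y, G.maxMatchingRoot < y → 0 < G.matchingEval Finset.univ y := by
  obtain ⟨y, hy⟩ : ∃ y, G.matchingEval Finset.univ y ≤ 0 := by
    by_contra! h
    obtain ⟨v⟩ := ‹Nonempty V›
    -- A single vertex has value y, which is not positive at y = 0; any bound below 0 would do.
    have := G.matchingEval_pos_of_subset Finset.univ (x := -1) (fun y _ => h y) {v}
      (Finset.subset_univ _) 0 (by norm_num)
    rw [matchingEval_singleton] at this
    exact lt_irrefl _ this
  obtain ⟨t, -, ht, hpos⟩ := G.exists_greatest_matchingEval_root _ hy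
  have hgr : IsGreatest G.matchingRoots t := by
    refine ⟨by rw [matchingRoots, Set.mem_ofPred_eq, eval_matchingPolynomial, ht], ?_⟩
    intro z hz
    rw [matchingRoots, Set.mem_ofPred_eq, eval_matchingPolynomial] at hz
    by_contra! hlt
    exact (hpos z hlt).ne' hz
  have heq : G.maxMatchingRoot = t := hgr.csSup_eq
  rw [heq]
  exact ⟨hgr, hpos⟩

theorem matchingEval_nonneg [Nonempty V] (G : SimpleGraph V) {x : ℝ}
    (hx : G.maxMatchingRoot ≤ x) (S : Finset V) : 0 ≤ G.matchingEval S x := by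
  refine ge_of_tendsto ((G.continuous_matchingEval S).continuousWithinAt (s := Set.Ioi x)) ?_
  filter_upwards [self_mem_nhdsWithin] with y hy
  exact (G.matchingEval_pos_of_subset _ G.isGreatest_maxMatchingRoot.2 S
    (Finset.subset_univ S) y (lt_of_le_of_lt hx hy)).le

/-! ### Strict positivity for graphs with one nontrivial component -/

/-- All edges of `G` lie in a single connected component: if no edge leaves `S`, then `S` or its
complement spans no edge. -/
def EdgesConnected {V : Type*} (G : SimpleGraph V) : Prop :=
  ∀ S : Set V, (∀ a ∈ S, ∀ b ∉ S, ¬ G.Adj a b) →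
    (∀ a ∈ S, ∀ b ∈ S, ¬ G.Adj a b) ∨ (∀ a ∉ S, ∀ b ∉ S, ¬ G.Adj a b)

theorem Connected.edgesConnected {V : Type*} {G : SimpleGraph V} (h : G.Connected) :
    G.EdgesConnected := by
  intro S hS
  by_cases hne : ∃ a, a ∈ S
  · right
    obtain ⟨a, ha⟩ := hne
    intro b hb
    obtain ⟨p⟩ := h.preconnected a b
    obtain ⟨d, -, hd1, hd2⟩ := p.exists_boundary_dart S ha hb
    exact absurd d.adj (hS _ hd1 _ hd2)
  · left
    push Not at hne
    exact fun a ha => absurd ha (hne a)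

/-- Deleting a non-isolated vertex of a graph with edges in a single component moves the largest
matching root strictly to the left. -/
theorem EdgesConnected.matchingEval_pos [Nonempty V] {G : SimpleGraph V} (hG : G.EdgesConnected)
    {x : ℝ} (hx : G.maxMatchingRoot ≤ x) {u w : V} (huw : G.Adj u w) (S : Finset V)
    (hu : u ∉ S) : 0 < G.matchingEval S x := by
  have hnn := G.matchingEval_nonneg hx
  -- The set {u} gives x ≥ 0, and the edge {u, w} gives x² - 1 ≥ 0.
  have hxpos : 0 < x := by
    have h1 := hnn {u}
    rw [matchingEval_singleton] at h1
    have h2 := hnn {u, w}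
    rw [matchingEval_insert G (by simpa using huw.ne), Finset.sum_singleton, if_pos huw,
      Finset.erase_singleton, matchingEval_singleton, matchingEval_empty] at h2
    nlinarith
  induction S using Finset.strongInduction with | _ S ih =>
  have hsmaller : ∀ z ∈ S, 0 < G.matchingEval (S.erase z) x := fun z hz =>
    ih _ (Finset.erase_ssubset hz) fun h => hu (Finset.mem_of_mem_erase h)
  refine lt_of_le_of_ne (hnn S) fun h0 => ?_
  have hne : S.Nonempty := by
    rw [Finset.nonempty_iff_ne_empty]
    rintro rfl
    rw [matchingEval_empty] at h0
    exact zero_ne_one h0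
  -- If m(S, x) = 0, an edge from b into S would make the value at `insert b S` negative.
  have hcut : ∀ a ∈ (S : Set V), ∀ b ∉ (S : Set V), ¬ G.Adj a b := by
    intro a ha b hb hab
    rw [Finset.mem_coe] at ha hb
    have hrec := G.matchingEval_insert hb x
    rw [← h0, mul_zero, zero_sub] at hrec
    have hsum : 0 < ∑ z ∈ S, (if G.Adj b z then (1 : ℝ) else 0) *
        G.matchingEval (S.erase z) x := by
      refine Finset.sum_pos' (fun z hz => mul_nonneg (by split_ifs <;> norm_num)
        (hsmaller z hz).le) ⟨a, ha, ?_⟩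
      rw [if_pos hab.symm, one_mul]
      exact hsmaller a ha
    linarith [hnn (insert b S)]
  rcases hG S hcut with h | h
  · obtain ⟨z, hz⟩ := hne
    have hrec := G.matchingEval_insert (Finset.notMem_erase z S) x
    rw [Finset.insert_erase hz, Finset.sum_eq_zero, sub_zero, ← h0] at hrec
    · exact (mul_pos hxpos (hsmaller z hz)).ne hrec
    · intro b hb
      rw [if_neg (h z hz b (Finset.mem_of_mem_erase hb)), zero_mul]
  · refine h u hu w (fun hw => hcut w hw u hu huw.symm) huw

/-! ### The Kelmans transformation and its effect on components -/

theorem kelmans_adj {V : Type*} (G : SimpleGraph V) {u v : V} (huv : u ≠ v) (a b : V) :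
    (G.kelmans u v).Adj a b ↔
      (G.Adj a b ∧ ¬ (a = v ∧ b ≠ u ∧ ¬ G.Adj u b) ∧ ¬ (b = v ∧ a ≠ u ∧ ¬ G.Adj u a)) ∨
        (a = u ∧ b ≠ u ∧ G.Adj v b) ∨ (b = u ∧ a ≠ u ∧ G.Adj v a) := by
  simp only [kelmans, kelmansMoved, fromEdgeSet_adj, Set.mem_union, Set.mem_sdiff, mem_edgeSet,
    Set.mem_ofPred_eq, Sym2.eq_iff]
  have h1 := G.adj_comm a b
  have h2 := G.adj_comm u v
  have h3 := fun w => G.irrefl (v := w)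
  constructor
  · rintro ⟨⟨h, h'⟩ | ⟨w, hw, h⟩, hab⟩
    · left
      refine ⟨h, ?_, ?_⟩
      · rintro ⟨rfl, hb, hub⟩
        exact h' ⟨b, ⟨h, hb, hub⟩, Or.inl ⟨rfl, rfl⟩⟩
      · rintro ⟨rfl, ha, hua⟩
        exact h' ⟨a, ⟨h.symm, ha, hua⟩, Or.inr ⟨rfl, rfl⟩⟩
    · grind
  · rintro (⟨h, hb, ha⟩ | ⟨rfl, hb, h⟩ | ⟨rfl, hb, h⟩)
    · refine ⟨Or.inl ⟨h, ?_⟩, h.ne⟩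
      grind
    · refine ⟨?_, hb.symm⟩
      by_cases hab : G.Adj a b
      · left
        refine ⟨hab, ?_⟩
        grind
      · exact Or.inr ⟨b, ⟨h, hb, hab⟩, Or.inl ⟨rfl, rfl⟩⟩
    · refine ⟨?_, hb⟩
      by_cases hab : G.Adj b a
      · left
        refine ⟨hab.symm, ?_⟩
        grind
      · exact Or.inr ⟨a, ⟨h, hb, hab⟩, Or.inr ⟨rfl, rfl⟩⟩

theorem EdgesConnected.kelmans {V : Type*} {G : SimpleGraph V} (hG : G.EdgesConnected) {u v : V}
    (huv : u ≠ v) : (G.kelmans u v).EdgesConnected := by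
  have hadj := G.kelmans_adj huv
  have main : ∀ S : Set V, u ∈ S → (∀ a ∈ S, ∀ b ∉ S, ¬ (G.kelmans u v).Adj a b) →
      (∀ a ∈ S, ∀ b ∈ S, ¬ (G.kelmans u v).Adj a b) ∨
        (∀ a ∉ S, ∀ b ∉ S, ¬ (G.kelmans u v).Adj a b) := by
    intro S hu hS
    -- Every new neighbour of v other than u is also a neighbour of u, so a cut separating v from u
    -- isolates v.
    have hv : v ∉ S → ∀ b, ¬ (G.kelmans u v).Adj v b := by
      intro hvS b hb
      have hbS : b ∉ S := fun h => hS b h v hvS hb.symm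
      refine hS u hu b hbS ?_
      have hbu : b ≠ u := fun h => hbS (h ▸ hu)
      rw [hadj] at hb ⊢
      grind
    -- A G-edge leaving `insert v S` would leave S after the transformation, with its end moved to u
    -- if it starts at v.
    have hcl : ∀ a ∈ insert v S, ∀ b ∉ insert v S, ¬ G.Adj a b := by
      intro a ha b hb hab
      have hbv : b ≠ v := fun h => hb (h ▸ Set.mem_insert v S)
      have hbS : b ∉ S := fun h => hb (Set.mem_insert_of_mem v h)
      have hbu : b ≠ u := fun h => hbS (h ▸ hu)
      rcases ha with rfl | ha
      · exact hS u hu b hbS ((hadj u b).2 (Or.inr (Or.inl ⟨rfl, hbu, hab⟩)))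
      · by_cases hav : a = v
        · subst hav
          exact hS u hu b hbS ((hadj u b).2 (Or.inr (Or.inl ⟨rfl, hbu, hab⟩)))
        · exact hS a ha b hbS ((hadj a b).2 (Or.inl ⟨hab, fun h => hav h.1, fun h => hbv h.1⟩))
    rcases hG _ hcl with h | h
    · left
      have hv0 : ∀ b, ¬ G.Adj v b := by
        intro b hb
        by_cases hbS : b ∈ insert v S
        · exact h v (Set.mem_insert v S) b hbS hb
        · exact hcl v (Set.mem_insert v S) b hbS hb
      intro a ha b hb hab
      have := h a (Set.mem_insert_of_mem v ha) b (Set.mem_insert_of_mem v hb)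
      rw [hadj] at hab
      grind
    · right
      intro a ha b hb hab
      have hav : a ≠ v := by
        rintro rfl
        exact hv ha b hab
      have hbv : b ≠ v := by
        rintro rfl
        exact hv hb a hab.symm
      have hau : a ≠ u := fun h => ha (h ▸ hu)
      have hbu : b ≠ u := fun h => hb (h ▸ hu)
      have := h a (fun h => h.elim hav ha) b (fun h => h.elim hbv hb)
      rw [hadj] at hab
      grind
  intro S hS
  by_cases hu : u ∈ S
  · exact main S hu hS
  · have := main Sᶜ hu fun a ha b hb hab => hS b (not_not.1 hb) a ha hab.symm
    simp only [Set.mem_compl_iff, not_not] at this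
    exact this.symm

/-! ### The difference formula -/

/-- The single sum involves only the sum of the two adjacency indicators, which the transformation
preserves, so only the double sum changes. -/
theorem matchingEval_insert_insert (G : SimpleGraph V) {W : Finset V} {u v : V} (huv : u ≠ v)
    (hu : u ∉ W) (hv : v ∉ W) (x : ℝ) :
    G.matchingEval (insert u (insert v W)) x =
      x ^ 2 * G.matchingEval W x - (if G.Adj u v then 1 else 0) * G.matchingEval W x
      - x * ∑ a ∈ W, ((if G.Adj u a then 1 else 0) + (if G.Adj v a then 1 else 0)) *
          G.matchingEval (W.erase a) x
      + ∑ a ∈ W, ∑ b ∈ W, (if G.Adj u a then 1 else 0) * (if G.Adj v b then 1 else 0) *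
          (if a = b then 0 else G.matchingEval ((W.erase a).erase b) x) := by
  have hu' : u ∉ insert v W := by simp [huv, hu]
  have hterm : ∀ a ∈ W, G.matchingEval ((insert v W).erase a) x =
      x * G.matchingEval (W.erase a) x - ∑ b ∈ W, (if G.Adj v b then 1 else 0) *
          (if a = b then 0 else G.matchingEval ((W.erase a).erase b) x) := by
    intro a ha
    have hva : v ≠ a := fun h => hv (h ▸ ha)
    rw [Finset.erase_insert_of_ne hva,
      matchingEval_insert G (fun h => hv (Finset.mem_of_mem_erase h)), ← Finset.add_sum_erase W _ ha,
      if_pos rfl, mul_zero, zero_add]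
    congr 1
    refine Finset.sum_congr rfl fun b hb => ?_
    rw [if_neg (Finset.ne_of_mem_erase hb).symm]
  have hsum : ∑ a ∈ W, (if G.Adj u a then (1 : ℝ) else 0) *
      G.matchingEval ((insert v W).erase a) x =
      x * ∑ a ∈ W, (if G.Adj u a then 1 else 0) * G.matchingEval (W.erase a) x -
      ∑ a ∈ W, ∑ b ∈ W, (if G.Adj u a then 1 else 0) * (if G.Adj v b then 1 else 0) *
          (if a = b then 0 else G.matchingEval ((W.erase a).erase b) x) := by
    rw [Finset.mul_sum, ← Finset.sum_sub_distrib]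
    refine Finset.sum_congr rfl fun a ha => ?_
    simp only [hterm a ha, mul_sub, Finset.mul_sum, mul_assoc, mul_left_comm x]
  rw [matchingEval_insert G hu', Finset.sum_insert hv, Finset.erase_insert hv,
    matchingEval_insert G hv, hsum]
  simp only [add_mul, Finset.sum_add_distrib]
  ring

theorem matchingEval_sub_kelmans (G : SimpleGraph V) {u v : V} (huv : u ≠ v) (x : ℝ) :
    G.matchingEval Finset.univ x - (G.kelmans u v).matchingEval Finset.univ x =
      ∑ a ∈ (Finset.univ.erase u).erase v, ∑ b ∈ (Finset.univ.erase u).erase v,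
        if (G.Adj u a ∧ ¬ G.Adj v a) ∧ (G.Adj v b ∧ ¬ G.Adj u b) then
          G.matchingEval ((((Finset.univ.erase u).erase v).erase a).erase b) x else 0 := by
  have hadj := G.kelmans_adj huv
  set W : Finset V := (Finset.univ.erase u).erase v with hW
  have hvW : v ∉ W := Finset.notMem_erase v _
  have huW : u ∉ W := fun h => Finset.notMem_erase u _ (Finset.mem_of_mem_erase h)
  have huniv : (Finset.univ : Finset V) = insert u (insert v W) := by
    rw [hW, Finset.insert_erase (by simp [huv.symm]), Finset.insert_erase (Finset.mem_univ u)]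
  have hne : ∀ a ∈ W, a ≠ u ∧ a ≠ v := fun a ha =>
    ⟨fun h => huW (h ▸ ha), fun h => hvW (h ▸ ha)⟩
  have hsame : ∀ T ⊆ W, (G.kelmans u v).matchingEval T x = G.matchingEval T x := by
    intro T hT
    refine matchingEval_congr (fun a ha b hb => ?_) x
    have h1 := hne a (hT ha)
    have h2 := hne b (hT hb)
    rw [hadj]
    grind
  have hkuv : (G.kelmans u v).Adj u v ↔ G.Adj u v := by
    rw [hadj]
    have := G.irrefl (v := v)
    grind
  -- Off u and v, the new neighbourhoods of u and v are the union and the intersection of the old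
  -- ones.
  have hku : ∀ a ∈ W, (if (G.kelmans u v).Adj u a then (1 : ℝ) else 0) =
      (if G.Adj u a then 1 else 0) + (if G.Adj v a then 1 else 0)
        - (if G.Adj u a then 1 else 0) * (if G.Adj v a then 1 else 0) := by
    intro a ha
    have h1 := hne a ha
    have : (G.kelmans u v).Adj u a ↔ G.Adj u a ∨ G.Adj v a := by
      rw [hadj]
      grind
    by_cases h : G.Adj u a <;> by_cases h' : G.Adj v a <;> simp [this, h, h']
  have hkv : ∀ a ∈ W, (if (G.kelmans u v).Adj v a then (1 : ℝ) else 0) =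
      (if G.Adj u a then 1 else 0) * (if G.Adj v a then 1 else 0) := by
    intro a ha
    have h1 := hne a ha
    have : (G.kelmans u v).Adj v a ↔ G.Adj u a ∧ G.Adj v a := by
      rw [hadj]
      grind
    by_cases h : G.Adj u a <;> by_cases h' : G.Adj v a <;> simp [this, h, h']
  set p : V → ℝ := fun a => if G.Adj u a then 1 else 0 with hp
  set q : V → ℝ := fun a => if G.Adj v a then 1 else 0 with hq
  set h : V → V → ℝ := fun a b =>
    if a = b then 0 else G.matchingEval ((W.erase a).erase b) x with hh
  have hsymm : ∀ a b, h a b = h b a := by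
    intro a b
    simp only [hh, eq_comm (a := a), Finset.erase_right_comm (a := a)]
  rw [huniv, matchingEval_insert_insert G huv huW hvW,
    matchingEval_insert_insert (G.kelmans u v) huv huW hvW, hsame W subset_rfl]
  have e1 : ∑ a ∈ W, ((if (G.kelmans u v).Adj u a then (1 : ℝ) else 0) +
      (if (G.kelmans u v).Adj v a then 1 else 0)) * (G.kelmans u v).matchingEval (W.erase a) x =
      ∑ a ∈ W, (p a + q a) * G.matchingEval (W.erase a) x := by
    refine Finset.sum_congr rfl fun a ha => ?_
    rw [hku a ha, hkv a ha, hsame _ (Finset.erase_subset _ _)]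
    ring
  have e2 : ∑ a ∈ W, ∑ b ∈ W, (if (G.kelmans u v).Adj u a then (1 : ℝ) else 0) *
      (if (G.kelmans u v).Adj v b then 1 else 0) *
      (if a = b then 0 else (G.kelmans u v).matchingEval ((W.erase a).erase b) x) =
      ∑ a ∈ W, ∑ b ∈ W, ((p a + q a - p a * q a) * (p b * q b)) * h a b := by
    refine Finset.sum_congr rfl fun a ha => Finset.sum_congr rfl fun b hb => ?_
    rw [hku a ha, hkv b hb,
      hsame _ ((Finset.erase_subset _ _).trans (Finset.erase_subset _ _))]
  -- Swapping a and b, under which h is symmetric, makes the remaining terms factor as p(1 - q) at a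
  -- times q(1 - p) at b.
  have e3 : ∑ a ∈ W, ∑ b ∈ W, (q a * (p b * q b)) * h a b =
      ∑ a ∈ W, ∑ b ∈ W, (p a * q a * q b) * h a b := by
    rw [Finset.sum_comm]
    refine Finset.sum_congr rfl fun a _ => Finset.sum_congr rfl fun b _ => ?_
    rw [hsymm b a]
    ring
  have e4 : ∑ a ∈ W, ∑ b ∈ W, (if (G.Adj u a ∧ ¬ G.Adj v a) ∧ (G.Adj v b ∧ ¬ G.Adj u b) then
      G.matchingEval ((W.erase a).erase b) x else 0) =
      ∑ a ∈ W, ∑ b ∈ W, (p a * q b * h a b - (p a * (p b * q b)) * h a b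
        - (p a * q a * q b) * h a b + (p a * q a * (p b * q b)) * h a b) := by
    refine Finset.sum_congr rfl fun a _ => Finset.sum_congr rfl fun b _ => ?_
    by_cases hab : a = b
    · subst hab
      simp only [hh, if_true, mul_zero]
      rw [if_neg (by tauto)]
      ring
    · simp only [hp, hq, hh, if_neg hab]
      by_cases h1 : G.Adj u a <;> by_cases h2 : G.Adj v a <;> by_cases h3 : G.Adj u b <;>
        by_cases h4 : G.Adj v b <;> simp [h1, h2, h3, h4]
  have e5 : ∑ a ∈ W, ∑ b ∈ W, ((p a + q a - p a * q a) * (p b * q b)) * h a b =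
      ∑ a ∈ W, ∑ b ∈ W, (p a * (p b * q b)) * h a b +
      ∑ a ∈ W, ∑ b ∈ W, (q a * (p b * q b)) * h a b -
      ∑ a ∈ W, ∑ b ∈ W, (p a * q a * (p b * q b)) * h a b := by
    simp only [← Finset.sum_add_distrib, ← Finset.sum_sub_distrib]
    refine Finset.sum_congr rfl fun a _ => Finset.sum_congr rfl fun b _ => ?_
    ring
  rw [e1, e2, e4, e5, e3]
  simp only [hkuv, Finset.sum_add_distrib, Finset.sum_sub_distrib]
  ring

/-! ### Comparison along Kelmans sequences -/

theorem kelmans_eq_self {V : Type*} (G : SimpleGraph V) {u v : V} (huv : u ≠ v)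
    (h : ∀ b, b ≠ u → G.Adj v b → G.Adj u b) : G.kelmans u v = G := by
  ext a b
  rw [kelmans_adj G huv]
  have h1 := G.adj_comm a b
  have ha := h a
  have hb := h b
  constructor
  · rintro (h | ⟨rfl, hbu, hv⟩ | ⟨rfl, hau, hv⟩)
    · exact h.1
    · exact hb hbu hv
    · exact (ha hau hv).symm
  · intro hab
    left
    grind

/-- If the neighbours of u already belong to v, the transformation merely exchanges the roles of u
and v. -/
theorem nonempty_iso_kelmans {V : Type*} (G : SimpleGraph V) {u v : V} (huv : u ≠ v)
    (h : ∀ a, a ≠ v → G.Adj u a → G.Adj v a) : Nonempty (G ≃g G.kelmans u v) := by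
  refine ⟨⟨Equiv.swap u v, fun {a b} => ?_⟩⟩
  rw [kelmans_adj G huv]
  have h1 := G.adj_comm a b
  have h2 := G.adj_comm u v
  have h3 := G.irrefl (v := u)
  have h4 := G.irrefl (v := v)
  have h5 := G.adj_comm a u
  have h6 := G.adj_comm a v
  have ha := h a
  have hb := h b
  by_cases hau : a = u <;> by_cases hav : a = v <;> by_cases hbu : b = u <;>
    by_cases hbv : b = v <;> simp_all [Equiv.swap_apply_def] <;> grind

theorem kelmans_dichotomy [Nonempty V] {G : SimpleGraph V} (hG : G.EdgesConnected) {u v : V}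
    (huv : u ≠ v) :
    (Nonempty (G ≃g G.kelmans u v) ∧
      ∀ x, G.matchingPolynomial.eval x = (G.kelmans u v).matchingPolynomial.eval x) ∨
      (G.kelmans u v).MatchingSucc G := by
  simp only [MatchingSucc, eval_matchingPolynomial]
  by_cases hA : ∃ a, a ≠ v ∧ G.Adj u a ∧ ¬ G.Adj v a
  · by_cases hB : ∃ b, b ≠ u ∧ G.Adj v b ∧ ¬ G.Adj u b
    · right
      intro x hx
      obtain ⟨a, hav, hua, hva⟩ := hA
      obtain ⟨b, hbu, hvb, hub⟩ := hB
      have hK : (G.kelmans u v).EdgesConnected := hG.kelmans huv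
      have hadj : (G.kelmans u v).Adj u b :=
        (G.kelmans_adj huv u b).2 (Or.inr (Or.inl ⟨rfl, hbu, hvb⟩))
      have hpos : ∀ c d, 0 < G.matchingEval
          ((((Finset.univ.erase u).erase v).erase c).erase d) x := by
        intro c d
        rw [matchingEval_congr (H := G.kelmans u v)]
        · exact hK.matchingEval_pos hx hadj _ (by simp)
        · intro y hy z hz
          simp only [Finset.mem_erase, Finset.mem_univ, and_true] at hy hz
          rw [kelmans_adj G huv]
          grind
      rw [← sub_pos, matchingEval_sub_kelmans G huv]
      have hterm : ∀ c d, 0 ≤ (if (G.Adj u c ∧ ¬ G.Adj v c) ∧ (G.Adj v d ∧ ¬ G.Adj u d) then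
          G.matchingEval ((((Finset.univ.erase u).erase v).erase c).erase d) x else 0) := by
        intro c d
        split_ifs
        · exact (hpos c d).le
        · exact le_rfl
      refine Finset.sum_pos' (fun c _ => Finset.sum_nonneg fun d _ => hterm c d)
        ⟨a, by simp [hav, hua.ne'], Finset.sum_pos' (fun d _ => hterm a d)
          ⟨b, by simp [hbu, hvb.ne'], ?_⟩⟩
      rw [if_pos ⟨⟨hua, hva⟩, hvb, hub⟩]
      exact hpos a b
    · left
      push Not at hB
      rw [kelmans_eq_self G huv hB]
      exact ⟨⟨Iso.refl⟩, fun _ => rfl⟩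
  · left
    push Not at hA
    refine ⟨nonempty_iso_kelmans G huv hA, fun x => ?_⟩
    rw [← sub_eq_zero, matchingEval_sub_kelmans G huv]
    refine Finset.sum_eq_zero fun c hc => Finset.sum_eq_zero fun d _ => if_neg ?_
    rintro ⟨⟨huc, hvc⟩, -⟩
    exact hvc (hA c (Finset.ne_of_mem_erase hc) huc)

/-- Otherwise, at the largest root of G, the value for H would be both negative and nonnegative. -/
theorem MatchingSucc.maxMatchingRoot_lt [Nonempty V] {G H : SimpleGraph V}
    (h : H.MatchingSucc G) : G.maxMatchingRoot < H.maxMatchingRoot := by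
  by_contra! hle
  have h1 := h _ hle
  have h2 := H.matchingEval_nonneg hle Finset.univ
  rw [← eval_matchingPolynomial] at h2
  have h3 : G.matchingPolynomial.eval G.maxMatchingRoot = 0 := G.isGreatest_maxMatchingRoot.1.1
  linarith

theorem maxMatchingRoot_congr {G H : SimpleGraph V}
    (h : ∀ x, G.matchingPolynomial.eval x = H.matchingPolynomial.eval x) :
    G.maxMatchingRoot = H.maxMatchingRoot := by
  simp only [maxMatchingRoot, matchingRoots, h]

/-- Strict comparisons compose because the largest root grows, so the range of x for a later graph
lies inside that for an earlier one. Isomorphic steps preserve the polynomial. -/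
theorem kelmans_sequence_dichotomy [Nonempty V] {G H : SimpleGraph V} (hG : G.EdgesConnected)
    (h : Relation.ReflTransGen KelmansStep G H) :
    H.EdgesConnected ∧ ((Nonempty (G ≃g H) ∧
      ∀ x, G.matchingPolynomial.eval x = H.matchingPolynomial.eval x) ∨ H.MatchingSucc G) := by
  induction h with
  | refl => exact ⟨hG, Or.inl ⟨⟨Iso.refl⟩, fun _ => rfl⟩⟩
  | @tail K L _ hstep ih =>
    obtain ⟨hK, ih⟩ := ih
    obtain ⟨u, v, huv, rfl⟩ := hstep
    refine ⟨hK.kelmans huv, ?_⟩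
    rcases kelmans_dichotomy hK huv with ⟨⟨e⟩, heq⟩ | hlt
    · rcases ih with ⟨⟨e'⟩, heq'⟩ | hlt'
      · exact Or.inl ⟨⟨e'.trans e⟩, fun x => (heq' x).trans (heq x)⟩
      · right
        intro x hx
        rw [← heq]
        exact hlt' x ((maxMatchingRoot_congr heq).trans_le hx)
    · right
      intro x hx
      have hKx := hlt x hx
      rcases ih with ⟨-, heq'⟩ | hlt'
      · rwa [heq']
      · exact hKx.trans (hlt' x (hlt.maxMatchingRoot_lt.le.trans hx))

end Classical

end SimpleGraph

theorem theorem3p9 {V : Type*} [Fintype V] (G G' : SimpleGraph V)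
    (hconn : G.Connected)
    (hseq : Relation.ReflTransGen SimpleGraph.KelmansStep G G')
    (hniso : ¬ Nonempty (G ≃g G')) :
    IsGreatest G.matchingRoots G.maxMatchingRoot ∧
      IsGreatest G'.matchingRoots G'.maxMatchingRoot ∧
      G'.MatchingSucc G ∧
      G.maxMatchingRoot < G'.maxMatchingRoot := by
  have := hconn.nonempty
  have hsucc : G'.MatchingSucc G :=
    (SimpleGraph.kelmans_sequence_dichotomy hconn.edgesConnected hseq).2.resolve_left
      fun h => hniso h.1
  exact ⟨G.isGreatest_maxMatchingRoot.1, G'.isGreatest_maxMatchingRoot.1, hsucc,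
    hsucc.maxMatchingRoot_lt⟩
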